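/- Let $V$ be a Hermitian space, i.e. a complex vector space with a positive definite Hermitian inner product $p^*q$, antilinear in $p$ and linear in $q$ ($V$ need be neither complete nor finite-dimensional). The Klauder space $Kl(V)$ is the set $\mathbb C\times V$, with elements $z=[z_0,\mathbf z]$, with the coherent product $K(z,z')=e^{\overline{z_0}+z_0'+\mathbf z^*\mathbf z'}$. Let $\mathbb Q$ be a quantum space of $Kl(V)$, i.e. a Hermitian space algebraically spanned by vectors $|z\rangle$ ($z\in Kl(V)$) with $\langle z|z'\rangle=K(z,z')$, and let $\mathbb Q^\times\supseteq\mathbb Q$ be the space of all antilinear functionals on $\mathbb Q$ with the topology of pointwise convergence. For $\rho\in\mathbb C$, $p,q\in V$ and an adjointable bounded linear map $\mathbf X:V\to V$ let $A=[\rho,p,q,\mathbf X]$ act on $Kl(V)$ by $A[z_0,\mathbf z]=[\rho+z_0+p^*\mathbf z,\,q+\mathbf X\mathbf z]$, with adjoint $A^*=[\overline\rho,q,p,\mathbf X^*]$. Let $\Gamma(A)$ be the linear operator on $\mathbb Q$ with $\Gamma(A)|z\rangle=|Az\rangle$, extended to $\mathbb Q^\times$ as the antidual of $\Gamma(A^*)$.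 For an element $X_{\rho,p,q,\mathbf X}$ of the oscillator algebra put $$d\Gamma(X_{\rho,p,q,\mathbf X})\phi:=\lim_{\varepsilon\to0,\ \varepsilon\in\mathbb R}\frac{\Gamma([\varepsilon\rho,\varepsilon p,\varepsilon q,1+\varepsilon\mathbf X])\phi-\phi}{\varepsilon}$$ for all $\phi\in\mathbb Q^\times$ for which the limit exists in $\mathbb Q^\times$. The annihilation operators are $p^*\mathbf a:=d\Gamma(X_{0,p,0,0})$ and the creation operators are $\mathbf a^*q:=d\Gamma(X_{0,0,q,0})$. For a partially defined operator $T$ on $\mathbb Q^\times$, $e^T$ denotes the linear operator on $\mathbb Q$ with $e^T\psi=\sum_{n\ge0}T^n\psi/n!$ for all $\psi\in\mathbb Q$ (all terms being defined, with convergence in $\mathbb Q^\times$), if there is one. (i) For all $p,q\in V$ the operators $e^{p^*\mathbf a}$, $e^{\mathbf a^*q}$ and $e^{p^*\mathbf a+\mathbf a^*q}$ on $\mathbb Q$ exist and are unique, and the Weyl relations hold: $$e^{p^*\mathbf a}e^{\mathbf a^*q}=e^{p^*q}\,e^{\mathbf a^*q}e^{p^*\mathbf a}.$$ (ii) The complex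 Weyl operators $W(p,q):=e^{p^*\mathbf a}e^{\mathbf a^*q}$ satisfy, for $p,p',q,q'\in V$, $$W(p,q)W(p',q')=e^{-p'^*q}\,W(p+p',q+q'),$$ $$W(p,q)^{-1}=e^{-p^*q}\,W(-p,-q),$$ $$W(p,q)W(p',q')=e^{p^*q'-p'^*q}\,W(p',q')W(p,q).$$ (iii) The exponentials $E(p,q):=e^{p^*\mathbf a+\mathbf a^*q}$ of the operator sums satisfy $$E(p,q)=e^{-\frac12p^*q}\,W(p,q),\qquad E(p,q)E(p',q')=e^{\frac12(p^*q'-p'^*q)}E(p+p',q+q'),$$ $$E(p,q)^{-1}=E(-p,-q),\qquad E(p,q)E(p',q')=e^{p^*q'-p'^*q}\,E(p',q')E(p,q).$$ (iv) The exponent $\sigma((p,q),(p',q')):=p^*q'-p'^*q$ in the commutation rules is a symplectic form on $V\times V$: it is real bilinear with values in $\mathbb C$, alternating and nondegenerate, and complex bilinear for the complex structure $\lambda(p,q)=(\overline\lambda p,\lambda q)$. -/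

import Mathlib

open Filter Topology Module
open scoped InnerProductSpace ComplexOrder ComplexConjugate

noncomputable section

/-! ### Coherent spaces and their quantum spaces -/

/-- A coherent space: a nonempty set with a coherent product `K` all of whose finite Gram matrices
are Hermitian and positive semidefinite. -/
class CoherentSpace (Z : Type*) where
  K : Z → Z → ℂ
  nonempty : Nonempty Z
  posSemidef : ∀ (n : ℕ) (z : Fin n → Z), (Matrix.of fun j k => K (z j) (z k)).PosSemidef

namespace CoherentSpace

theorem conj_K {Z : Type*} [CoherentSpace Z] (z z' : Z) : conj (K z z') = K z' z := by
  have h := (posSemidef 2 ![z', z]).isHermitian.apply 0 1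
  simpa using h

end CoherentSpace

open CoherentSpace

/-- A quantum space of a coherent space `Z`: a Hermitian space `Q` (a complex inner product space,
not assumed complete) that is algebraically spanned by coherent states `ket z` whose inner
products are given by the coherent product. -/
structure QuantumSpace (Z : Type*) [CoherentSpace Z]
    (Q : Type*) [NormedAddCommGroup Q] [InnerProductSpace ℂ Q] where
  ket : Z → Q
  inner_ket : ∀ z z' : Z, ⟪ket z, ket z'⟫_ℂ = K z z'
  span_ket : Submodule.span ℂ (Set.range ket) = ⊤

/-- The augmented quantum space of a Hermitian space: its antidual, the space of all antilinear
functionals. -/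
abbrev Antidual (Q : Type*) [NormedAddCommGroup Q] [InnerProductSpace ℂ Q] : Type _ :=
  Q →ₗ⋆[ℂ] ℂ

/-- The canonical embedding of a Hermitian space into its antidual, `ψ ↦ (χ ↦ ⟨χ, ψ⟩)`. -/
def toAntidual (Q : Type*) [NormedAddCommGroup Q] [InnerProductSpace ℂ Q] :
    Q →ₗ[ℂ] Antidual Q :=
  (innerₛₗ ℂ (E := Q)).flip

theorem toAntidual_apply {Q : Type*} [NormedAddCommGroup Q] [InnerProductSpace ℂ Q] (ψ χ : Q) :
    toAntidual Q ψ χ = ⟪χ, ψ⟫_ℂ := rfl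

/-- A coherent map of `Z`, together with an adjoint map. -/
structure CoherentMap (Z : Type*) [CoherentSpace Z] where
  toFun : Z → Z
  adj : Z → Z
  K_adj : ∀ z z' : Z, K (adj z) z' = K z (toFun z')

/-- The adjoint coherent map `A*`. -/
def CoherentMap.star {Z : Type*} [CoherentSpace Z] (A : CoherentMap Z) : CoherentMap Z where
  toFun := A.adj
  adj := A.toFun
  K_adj z z' := by rw [← conj_K, ← A.K_adj, conj_K]

namespace QuantumSpace

variable {Z : Type*} [CoherentSpace Z] {Q : Type*} [NormedAddCommGroup Q] [InnerProductSpace ℂ Q]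

theorem eq_zero_of_inner_ket (S : QuantumSpace Z Q) {ψ : Q}
    (h : ∀ z, ⟪S.ket z, ψ⟫_ℂ = 0) : ψ = 0 := by
  have key : ∀ χ : Q, ⟪χ, ψ⟫_ℂ = 0 := by
    intro χ
    have hχ : χ ∈ Submodule.span ℂ (Set.range S.ket) := by rw [S.span_ket]; trivial
    induction hχ using Submodule.span_induction with
    | mem x hx => obtain ⟨z, rfl⟩ := hx; exact h z
    | zero => simp
    | add x y _ _ hx hy => rw [inner_add_left, hx, hy, add_zero]
    | smul a x _ hx => rw [inner_smul_left, hx, mul_zero]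
  exact inner_self_eq_zero.mp (key ψ)

theorem existsUnique_quantize (S : QuantumSpace Z Q) (A : CoherentMap Z) :
    ∃! G : Q →ₗ[ℂ] Q, ∀ z, G (S.ket z) = S.ket (A.toFun z) := by
  let L := Finsupp.linearCombination ℂ S.ket
  let M := Finsupp.linearCombination ℂ (fun z => S.ket (A.toFun z))
  have hL : LinearMap.range L = ⊤ := by rw [Finsupp.range_linearCombination, S.span_ket]
  have hM : ∀ (f : Z →₀ ℂ) (z : Z), ⟪S.ket z, M f⟫_ℂ = ⟪S.ket (A.adj z), L f⟫_ℂ := by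
    intro f z
    simp only [L, M, Finsupp.linearCombination_apply, Finsupp.sum, inner_sum, inner_smul_right,
      S.inner_ket, A.K_adj]
  obtain ⟨R, hR⟩ := L.exists_rightInverse_of_surjective hL
  refine ⟨M ∘ₗ R, fun z => ?_, fun G hG => ?_⟩
  · have h1 : M (R (S.ket z)) = M (Finsupp.single z 1) := by
      rw [← sub_eq_zero]
      refine S.eq_zero_of_inner_ket fun w => ?_
      have h2 : L (R (S.ket z)) = S.ket z := LinearMap.congr_fun hR _
      rw [inner_sub_right, hM, hM, h2]
      simp [L]
    simpa [M] using h1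
  · refine LinearMap.ext_on_range S.span_ket fun z => ?_
    have h1 : M (R (S.ket z)) = M (Finsupp.single z 1) := by
      rw [← sub_eq_zero]
      refine S.eq_zero_of_inner_ket fun w => ?_
      have h2 : L (R (S.ket z)) = S.ket z := LinearMap.congr_fun hR _
      rw [inner_sub_right, hM, hM, h2]
      simp [L]
    rw [hG, LinearMap.comp_apply, h1]
    simp [M]

/-- The quantization `Γ(A)` of a coherent map `A`: the unique linear operator on the quantum space
with `Γ(A)|z⟩ = |A z⟩`. -/
def quantize (S : QuantumSpace Z Q) (A : CoherentMap Z) : Q →ₗ[ℂ] Q :=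
  (S.existsUnique_quantize A).choose

theorem quantize_ket (S : QuantumSpace Z Q) (A : CoherentMap Z) (z : Z) :
    S.quantize A (S.ket z) = S.ket (A.toFun z) :=
  (S.existsUnique_quantize A).choose_spec.1 z

/-- The extension of `Γ(A)` to the augmented quantum space, `Γ(A) := Γ(A*)*`. -/
def quantizeDual (S : QuantumSpace Z Q) (A : CoherentMap Z) : Antidual Q →ₗ[ℂ] Antidual Q where
  toFun φ := φ.comp (S.quantize A.star)
  map_add' _ _ := rfl
  map_smul' _ _ := rfl

/-- The extension of `Γ(A)` to the augmented quantum space really extends `Γ(A)`. -/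
theorem quantizeDual_toAntidual (S : QuantumSpace Z Q) (A : CoherentMap Z) (ψ : Q) :
    S.quantizeDual A (toAntidual Q ψ) = toAntidual Q (S.quantize A ψ) := by
  refine LinearMap.ext_on_range S.span_ket fun z => ?_
  change ⟪S.quantize A.star (S.ket z), ψ⟫_ℂ = ⟪S.ket z, S.quantize A ψ⟫_ℂ
  have hψ : ψ ∈ Submodule.span ℂ (Set.range S.ket) := by rw [S.span_ket]; trivial
  induction hψ using Submodule.span_induction with
  | mem x hx =>
    obtain ⟨w, rfl⟩ := hx
    rw [quantize_ket, quantize_ket, S.inner_ket, S.inner_ket]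
    exact A.K_adj z w
  | zero => simp
  | add x y _ _ hx hy => rw [inner_add_right, map_add, inner_add_right, hx, hy]
  | smul a x _ hx => rw [inner_smul_right, map_smul, inner_smul_right, hx]

end QuantumSpace

/-! ### Exponentials of partially defined operators on the augmented quantum space -/

/-- `U : Q → Q` is the exponential on `Q` of the partially defined operator `T` on the antidual of
`Q`: for every `ψ` in `Q`, all iterates `Tⁿ ψ` are defined, and `∑ Tⁿ ψ / n!` converges to `U ψ` in
the topology of the antidual (pointwise on `Q`). -/
def IsExp {Q : Type*} [NormedAddCommGroup Q] [InnerProductSpace ℂ Q]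
    (T : Antidual Q →ₗ.[ℂ] Antidual Q) (U : End ℂ Q) : Prop :=
  ∀ ψ : Q, ∃ s : ℕ → Antidual Q,
    s 0 = toAntidual Q ψ ∧
    (∀ n, ∃ h : s n ∈ T.domain, T ⟨s n, h⟩ = s (n + 1)) ∧
    ∀ χ : Q, HasSum (fun n : ℕ => ((n.factorial : ℂ)⁻¹) * s n χ) (toAntidual Q (U ψ) χ)

open scoped Classical in
/-- The exponential `e^T` as an operator on `Q` (with value `0` if it does not exist). -/
def opExp {Q : Type*} [NormedAddCommGroup Q] [InnerProductSpace ℂ Q]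
    (T : Antidual Q →ₗ.[ℂ] Antidual Q) : End ℂ Q :=
  if h : ∃ U, IsExp T U then h.choose else 0

/-! ### The Klauder space -/

/-- The Klauder space `Kl(V) = ℂ × V`. -/
@[ext] structure Kl (V : Type*) where
  zero : ℂ
  vec : V

namespace Kl

variable {V : Type*} [NormedAddCommGroup V] [InnerProductSpace ℂ V]

/-- The coherent product of the Klauder space. -/
def prod (z z' : Kl V) : ℂ := Complex.exp (conj z.zero + z'.zero + ⟪z.vec, z'.vec⟫_ℂ)

theorem posSemidef_exp {n : ℕ} {G : Matrix (Fin n) (Fin n) ℂ} (hG : G.PosSemidef) :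
    (Matrix.of fun j k => Complex.exp (G j k)).PosSemidef := by
  have hpow : ∀ m : ℕ, (Matrix.of fun j k => (G j k) ^ m).PosSemidef := by
    intro m
    induction m with
    | zero =>
      have := Matrix.posSemidef_vecMulVec_self_star (fun _ : Fin n => (1 : ℂ))
      convert this using 1
      ext j k
      simp [Matrix.vecMulVec]
    | succ m ih =>
      have h := ih.hadamard hG
      have e : (Matrix.of fun j k => G j k ^ (m + 1)) =
          (Matrix.of fun j k => G j k ^ m).hadamard G := by
        ext j k
        simp [Matrix.hadamard, pow_succ]
      rw [e]
      exact h
  rw [Matrix.posSemidef_iff_dotProduct_mulVec]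
  have herm : (Matrix.of fun j k => Complex.exp (G j k)).IsHermitian := by
    ext j k
    have := hG.isHermitian.apply j k
    simp only [Matrix.conjTranspose_apply, Matrix.of_apply]
    rw [← this]
    exact (Complex.exp_conj _).symm
  refine ⟨herm, fun x => ?_⟩
  have hs : HasSum (fun m : ℕ => ((m.factorial : ℂ)⁻¹) *
      (star x ⬝ᵥ ((Matrix.of fun j k => (G j k) ^ m).mulVec x)))
      (star x ⬝ᵥ ((Matrix.of fun j k => Complex.exp (G j k)).mulVec x)) := by
    simp only [dotProduct, Matrix.mulVec, Matrix.of_apply, Finset.mul_sum]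
    refine hasSum_sum fun j _ => hasSum_sum fun k _ => ?_
    have h := NormedSpace.expSeries_div_hasSum_exp (G j k)
    rw [← Complex.exp_eq_exp_ℂ] at h
    have h2 := (h.mul_left (star x j)).mul_right (x k)
    simp only [Pi.star_apply] at h2 ⊢
    have e1 : star (x j) * (Complex.exp (G j k) * x k)
        = star (x j) * Complex.exp (G j k) * x k := by ring
    have e2 : (fun m : ℕ => ((m.factorial : ℂ)⁻¹) * (star (x j) * (G j k ^ m * x k)))
        = fun m : ℕ => star (x j) * (G j k ^ m / (m.factorial : ℂ)) * x k := by
      funext m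
      ring
    rw [e1, e2]
    exact h2
  refine hs.nonneg fun m => ?_
  exact mul_nonneg (by positivity) ((hpow m).dotProduct_mulVec_nonneg x)

theorem posSemidef_prod (n : ℕ) (z : Fin n → Kl V) :
    (Matrix.of fun j k => prod (z j) (z k)).PosSemidef := by
  have h1 := posSemidef_exp (Matrix.posSemidef_gram ℂ (fun j => (z j).vec))
  have h2 := Matrix.posSemidef_vecMulVec_star_self (fun j => Complex.exp (z j).zero)
  have h := h1.hadamard h2
  have e : (Matrix.of fun j k => prod (z j) (z k)) =
      (Matrix.of fun j k => Complex.exp (Matrix.gram ℂ (fun j => (z j).vec) j k)).hadamard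
        (Matrix.vecMulVec (star fun j => Complex.exp (z j).zero)
          (fun j => Complex.exp (z j).zero)) := by
    ext j k
    simp only [Matrix.of_apply, Matrix.hadamard_apply, Matrix.gram_apply, Matrix.vecMulVec_apply,
      Pi.star_apply, prod, Complex.exp_add]
    rw [Complex.exp_conj]
    simp only [starRingEnd_apply]
    ring
  rw [e]
  exact h

instance : CoherentSpace (Kl V) where
  K := prod
  nonempty := ⟨⟨0, 0⟩⟩
  posSemidef := posSemidef_prod

end Kl

/-! ### The oscillator semigroup and the oscillator algebra -/

/-- A horizontal map of a Hermitian space: a bounded linear map `V → V` with an adjoint `V → V`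
(it acts on an antilinear functional `φ` of `V` by `φ ↦ φ ∘ adj`). -/
@[ext] structure Hor (V : Type*) [NormedAddCommGroup V] [InnerProductSpace ℂ V] where
  map : V →L[ℂ] V
  adj : V →L[ℂ] V
  inner_adj : ∀ x y : V, ⟪adj x, y⟫_ℂ = ⟪x, map y⟫_ℂ

namespace Hor

variable {V : Type*} [NormedAddCommGroup V] [InnerProductSpace ℂ V]

/-- The zero map. -/
def zero : Hor V := ⟨0, 0, by simp⟩

/-- The map `1 + ε X` for real `ε`. -/
def oneAddSmul (ε : ℝ) (X : Hor V) : Hor V where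
  map := 1 + (ε : ℂ) • X.map
  adj := 1 + (ε : ℂ) • X.adj
  inner_adj x y := by
    change ⟪x + (ε : ℂ) • X.adj x, y⟫_ℂ = ⟪x, y + (ε : ℂ) • X.map y⟫_ℂ
    rw [inner_add_left, inner_add_right, inner_smul_left, inner_smul_right, X.inner_adj,
      Complex.conj_ofReal]

end Hor

/-- An element `[ρ, p, q, X]` of the oscillator semigroup `Os(V)`, that is, the operator matrix
`(1, p*, ρ; 0, X, q; 0, 0, 1)` on `ℂ × V × ℂ`. -/
@[ext] structure Os (V : Type*) [NormedAddCommGroup V] [InnerProductSpace ℂ V] where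
  rho : ℂ
  p : V
  q : V
  X : Hor V

/-- An element `X_{ρ, p, q, X}` of the oscillator algebra `os(V)`, that is, the operator matrix
`(0, p*, ρ; 0, X, q; 0, 0, 0)` on `ℂ × V × ℂ`. -/
@[ext] structure OsAlg (V : Type*) [NormedAddCommGroup V] [InnerProductSpace ℂ V] where
  rho : ℂ
  p : V
  q : V
  X : Hor V

section Oscillator

variable {V : Type*} [NormedAddCommGroup V] [InnerProductSpace ℂ V]

/-- The action `[ρ, p, q, X] [z₀, z] = [ρ + z₀ + p* z, q + X z]` of the oscillator semigroup on the
Klauder space. -/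
def Os.act (A : Os V) (z : Kl V) : Kl V :=
  ⟨A.rho + z.zero + ⟪A.p, z.vec⟫_ℂ, A.q + A.X.map z.vec⟩

/-- The element of the oscillator semigroup acting as a coherent map of the Klauder space, with
adjoint map `z ↦ [conj ρ, q, p, X*] z`. -/
def Os.toCoherentMap (A : Os V) : CoherentMap (Kl V) where
  toFun := A.act
  adj z := ⟨conj A.rho + z.zero + ⟪A.q, z.vec⟫_ℂ, A.p + A.X.adj z.vec⟩
  K_adj z z' := by
    change Kl.prod _ _ = Kl.prod _ _
    simp only [Kl.prod, Os.act, map_add, Complex.conj_conj, inner_conj_symm, inner_add_left,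
      inner_add_right, A.X.inner_adj]
    congr 1
    ring

/-- The element `[ε ρ, ε p, ε q, 1 + ε X]` of the oscillator semigroup (`ε` real). -/
def OsAlg.approx (X : OsAlg V) (ε : ℝ) : Os V :=
  ⟨(ε : ℂ) * X.rho, (ε : ℂ) • X.p, (ε : ℂ) • X.q, Hor.oneAddSmul ε X.X⟩

variable {Q : Type*} [NormedAddCommGroup Q] [InnerProductSpace ℂ Q]

namespace QuantumSpace

/-- `ψ = lim_{ε → 0} ε⁻¹ (Γ([ε ρ, ε p, ε q, 1 + ε X]) φ - φ)`, the limit (over real `ε ≠ 0`) being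
taken in the antidual, i.e. pointwise on the quantum space. -/
def IsDGamma (S : QuantumSpace (Kl V) Q) (X : OsAlg V) (φ ψ : Antidual Q) : Prop :=
  ∀ χ : Q, Tendsto
    (fun ε : ℝ => (ε : ℂ)⁻¹ * (S.quantizeDual (X.approx ε).toCoherentMap φ χ - φ χ))
    (𝓝[≠] 0) (𝓝 (ψ χ))

theorem IsDGamma.unique {S : QuantumSpace (Kl V) Q} {X : OsAlg V} {φ ψ ψ' : Antidual Q}
    (h : S.IsDGamma X φ ψ) (h' : S.IsDGamma X φ ψ') : ψ = ψ' :=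
  LinearMap.ext fun χ => tendsto_nhds_unique (h χ) (h' χ)

theorem IsDGamma.add {S : QuantumSpace (Kl V) Q} {X : OsAlg V} {φ ψ φ' ψ' : Antidual Q}
    (h : S.IsDGamma X φ ψ) (h' : S.IsDGamma X φ' ψ') : S.IsDGamma X (φ + φ') (ψ + ψ') := by
  intro χ
  refine ((h χ).add (h' χ)).congr fun ε => ?_
  simp only [map_add, LinearMap.add_apply]
  ring

theorem IsDGamma.smul {S : QuantumSpace (Kl V) Q} {X : OsAlg V} {φ ψ : Antidual Q} (c : ℂ)
    (h : S.IsDGamma X φ ψ) : S.IsDGamma X (c • φ) (c • ψ) := by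
  intro χ
  refine ((h χ).const_mul c).congr fun ε => ?_
  simp only [map_smul, LinearMap.smul_apply, smul_eq_mul]
  ring

theorem isDGamma_zero (S : QuantumSpace (Kl V) Q) (X : OsAlg V) : S.IsDGamma X 0 0 := by
  intro χ
  simp

/-- The operator `dΓ(X)` on the augmented quantum space, defined on all functionals for which the
defining limit exists. -/
def dGamma (S : QuantumSpace (Kl V) Q) (X : OsAlg V) : Antidual Q →ₗ.[ℂ] Antidual Q where
  domain :=
    { carrier := {φ | ∃ ψ, S.IsDGamma X φ ψ}
      add_mem' := fun ⟨ψ, h⟩ ⟨ψ', h'⟩ => ⟨ψ + ψ', h.add h'⟩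
      zero_mem' := ⟨0, S.isDGamma_zero X⟩
      smul_mem' := fun c _ ⟨ψ, h⟩ => ⟨c • ψ, h.smul c⟩ }
  toFun :=
    { toFun := fun φ => φ.2.choose
      map_add' := fun φ φ' =>
        (φ + φ').2.choose_spec.unique (φ.2.choose_spec.add φ'.2.choose_spec)
      map_smul' := fun c φ => (c • φ).2.choose_spec.unique (φ.2.choose_spec.smul c) }

/-- The annihilation operator `p* a = dΓ(X_{0, p, 0, 0})`. -/
def annihilation (S : QuantumSpace (Kl V) Q) (p : V) : Antidual Q →ₗ.[ℂ] Antidual Q :=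
  S.dGamma ⟨0, p, 0, Hor.zero⟩

/-- The creation operator `a* q = dΓ(X_{0, 0, q, 0})`. -/
def creation (S : QuantumSpace (Kl V) Q) (q : V) : Antidual Q →ₗ.[ℂ] Antidual Q :=
  S.dGamma ⟨0, 0, q, Hor.zero⟩

/-- The complex Weyl operator `W(p, q)`, the exponential of `p* a + a* q` ordered with the
annihilation part on the left: `W(p, q) = e^{p* a} e^{a* q}`. -/
def weyl (S : QuantumSpace (Kl V) Q) (p q : V) : End ℂ Q :=
  opExp (S.annihilation p) * opExp (S.creation q)

/-- The unordered exponential `e^{p* a + a* q}` of the operator sum. -/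
def expSum (S : QuantumSpace (Kl V) Q) (p q : V) : End ℂ Q :=
  opExp (S.annihilation p + S.creation q)

end QuantumSpace

/-- The form `σ((p, q), (p', q')) = p* q' - p'* q` on `V × V`, as a real bilinear map. -/
def weylForm (V : Type*) [NormedAddCommGroup V] [InnerProductSpace ℂ V] :
    (V × V) →ₗ[ℝ] (V × V) →ₗ[ℝ] ℂ :=
  LinearMap.mk₂ ℝ (fun x y => ⟪x.1, y.2⟫_ℂ - ⟪y.1, x.2⟫_ℂ)
    (fun x x' y => by simp only [Prod.fst_add, Prod.snd_add, inner_add_left, inner_add_right]; ring)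
    (fun c x y => by
      simp only [Prod.smul_fst, Prod.smul_snd, ← Complex.coe_smul, inner_smul_left,
        inner_smul_right, Complex.conj_ofReal, smul_eq_mul]
      ring)
    (fun x y y' => by simp only [Prod.fst_add, Prod.snd_add, inner_add_left, inner_add_right]; ring)
    (fun c x y => by
      simp only [Prod.smul_fst, Prod.smul_snd, ← Complex.coe_smul, inner_smul_left,
        inner_smul_right, Complex.conj_ofReal, smul_eq_mul]
      ring)

end Oscillator

/-! ### Every coherent space has a quantum space -/

universe u

/-- Every coherent space has a quantum space. -/
theorem QuantumSpace.exists (Z : Type u) [CoherentSpace Z] :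
    ∃ (Q : Type u) (_ : NormedAddCommGroup Q) (_ : InnerProductSpace ℂ Q),
      Nonempty (QuantumSpace Z Q) := by
  let M : Matrix Z Z (ℂ →L[ℂ] ℂ) := .of fun z z' => ContinuousLinearMap.mul ℂ ℂ (K z z')
  have hM0 : M.IsHermitian := by
    ext z z'
    refine ext_inner_right ℂ fun w => ?_
    rw [Matrix.conjTranspose_apply, ContinuousLinearMap.star_eq_adjoint,
      ContinuousLinearMap.adjoint_inner_left]
    simp [M, conj_K, mul_comm]
  have hM : M.PosSemidef := by
    have key := (RKHS.posSemidef_tfae (K := M)).out 0 2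
    refine key.mpr ⟨hM0, fun f => ?_⟩
    let e := f.support.equivFin
    have h := (posSemidef f.support.card
      (fun j => ((e.symm j : f.support) : Z))).dotProduct_mulVec_nonneg
      (fun j => f (e.symm j : f.support))
    have h2 : (f.sum fun x w => f.sum fun x' w' => ⟪M x' x w, w'⟫_ℂ) =
        conj (star (fun j => f (e.symm j : f.support)) ⬝ᵥ
          ((Matrix.of fun j k => K ((e.symm j : f.support) : Z) ((e.symm k : f.support) : Z)).mulVec
            (fun j => f (e.symm j : f.support)))) := by
      have hsum : ∀ g : Z → ℂ, ∑ x ∈ f.support, g x =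
          ∑ j : Fin f.support.card, g ((e.symm j : f.support) : Z) := by
        intro g
        rw [← Finset.sum_coe_sort]
        exact (Equiv.sum_comp e.symm (fun x : f.support => g x)).symm
      simp only [Finsupp.sum, dotProduct, Matrix.mulVec, map_sum, map_mul, Matrix.of_apply,
        Pi.star_apply, RCLike.star_def, RCLike.conj_conj, hsum]
      rw [Finset.sum_comm]
      refine Finset.sum_congr rfl fun j _ => ?_
      rw [Finset.mul_sum]
      refine Finset.sum_congr rfl fun k _ => ?_
      simp [M]
    rw [h2, RCLike.conj_re]
    exact (RCLike.nonneg_iff.mp h).1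
  have : Fact M.PosSemidef := ⟨hM⟩
  let H := RKHS.OfKernel M
  let k : Z → H := fun z => RKHS.kerFun H z 1
  let Q := Submodule.span ℂ (Set.range k)
  refine ⟨Q, inferInstance, inferInstance,
    ⟨⟨fun z => ⟨k z, Submodule.subset_span ⟨z, rfl⟩⟩, ?_, ?_⟩⟩⟩
  · intro z z'
    change ⟪RKHS.kerFun H z 1, RKHS.kerFun H z' 1⟫_ℂ = _
    rw [← RKHS.kernel_inner, RKHS.OfKernel.kernel_ofKernel]
    simp [M, conj_K]
  · rw [← Submodule.span_span_coe_preimage]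
    congr 1
    ext x
    constructor
    · rintro ⟨z, rfl⟩
      exact ⟨z, rfl⟩
    · rintro ⟨z, hz⟩
      exact ⟨z, Subtype.ext hz⟩

end

open Filter Topology Module
open scoped InnerProductSpace ComplexOrder ComplexConjugate
open CoherentSpace

noncomputable section

/-! ### Uniqueness and existence of exponentials -/

section Exponential

variable {Q : Type*} [NormedAddCommGroup Q] [InnerProductSpace ℂ Q]

/-! Every operator in the theorem is the quantization of a Heisenberg element `[ρ, p, q, 1]`.
Writing `c = p*q`, the exponentials of `p*a`, `a*q` and `p*a + a*q` have central parameter `ρ = 0`,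
`0` and `c / 2`, and the Weyl operator has `ρ = c`. Heisenberg operators multiply by adding `p` and
`q` and adding `ρ + ρ' + p*q'` (`heisenberg_mul`), and a scalar `e^a` only shifts `ρ` by `a`
(`exp_smul_heisenberg`). All relations thus become additive identities between central parameters.

The analytic part is identifying the exponentials. A functional is determined by its values on
coherent states, and there `dΓ` is an ordinary derivative in `ε`. On functionals `z ↦ f(z) K(z, w)`,
creation multiplies `f` by `z*q`. Annihilation multiplies by `p*w` and, when `f` is a function of
`z*q`, adds `c` times its derivative. For `y = z*q + p*w` the sum therefore acts as `y + c d/dy`.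
Its iterates on `1` have the generating function `exp (t y + c t² / 2)`, whose value at `t = 1`
gives the central term `c / 2`. -/

theorem toAntidual_injective : Function.Injective (toAntidual Q) := fun _ _ h =>
  ext_inner_left ℂ fun χ => LinearMap.congr_fun h χ

/-- The iterates are forced because `T` is single-valued, the sums because limits in `ℂ` are unique,
and a vector is recovered from its functional. -/
theorem IsExp.unique {T : Antidual Q →ₗ.[ℂ] Antidual Q} {U U' : End ℂ Q}
    (h : IsExp T U) (h' : IsExp T U') : U = U' := by
  refine LinearMap.ext fun ψ => toAntidual_injective (LinearMap.ext fun χ => ?_)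
  obtain ⟨s, s0, hs, hsum⟩ := h ψ
  obtain ⟨s', s0', hs', hsum'⟩ := h' ψ
  have e : ∀ n, s n = s' n := by
    intro n
    induction n with
    | zero => rw [s0, s0']
    | succ n ih =>
      obtain ⟨d, hd⟩ := hs n
      obtain ⟨d', hd'⟩ := hs' n
      rw [← hd, ← hd']
      congr 1
      exact Subtype.ext ih
  refine (hsum χ).unique ?_
  simpa only [e] using hsum' χ

theorem IsExp.opExp_eq {T : Antidual Q →ₗ.[ℂ] Antidual Q} {U : End ℂ Q} (h : IsExp T U) :
    opExp T = U := by
  have hex : ∃ U, IsExp T U := ⟨U, h⟩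
  rw [opExp, dif_pos hex]
  exact hex.choose_spec.unique h

theorem IsExp.existsUnique {T : Antidual Q →ₗ.[ℂ] Antidual Q} {U : End ℂ Q} (h : IsExp T U) :
    ∃! U, IsExp T U :=
  ⟨U, h, fun _ h' => h'.unique h⟩

variable {Z : Type*} [CoherentSpace Z]

/-- An exponential may be computed on coherent states: it suffices to know the values `G w n z` of
the functionals `Tⁿ|w⟩` on the coherent states `|z⟩`. -/
theorem QuantumSpace.isExp_of_ket (S : QuantumSpace Z Q) {T : Antidual Q →ₗ.[ℂ] Antidual Q}
    {U : End ℂ Q} (G : Z → ℕ → Z → ℂ) (h0 : ∀ w z, G w 0 z = K z w)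
    (hT : ∀ w n φ, (∀ z, φ (S.ket z) = G w n z) →
      ∃ ψ, (∃ h : φ ∈ T.domain, T ⟨φ, h⟩ = ψ) ∧ ∀ z, ψ (S.ket z) = G w (n + 1) z)
    (hsum : ∀ w z, HasSum (fun n : ℕ => ((n.factorial : ℂ)⁻¹) * G w n z)
      ⟪S.ket z, U (S.ket w)⟫_ℂ) : IsExp T U := by
  intro ψ
  have hψ : ψ ∈ Submodule.span ℂ (Set.range S.ket) := by rw [S.span_ket]; trivial
  induction hψ using Submodule.span_induction with
  | mem x hx =>
    obtain ⟨w, rfl⟩ := hx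
    -- The iterates are built recursively, each carrying its known values on coherent states, since
    -- these values are what puts it in the domain of `T`.
    choose! next hdom hnext using hT w
    let s : ∀ n, {φ : Antidual Q // ∀ z, φ (S.ket z) = G w n z} := fun n =>
      Nat.rec ⟨toAntidual Q (S.ket w), fun z => by rw [toAntidual_apply, S.inner_ket, h0]⟩
        (fun n φ => ⟨next n φ.1, hnext n φ.1 φ.2⟩) n
    refine ⟨fun n => (s n).1, rfl, fun n => hdom n (s n).1 (s n).2, fun χ => ?_⟩
    have hχ : χ ∈ Submodule.span ℂ (Set.range S.ket) := by rw [S.span_ket]; trivial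
    induction hχ using Submodule.span_induction with
    | mem x hx =>
      obtain ⟨z, rfl⟩ := hx
      simp only [(s _).2]
      exact hsum w z
    | zero => simpa only [map_zero, mul_zero] using hasSum_zero
    | add x y _ _ hx hy => simpa only [map_add, mul_add] using hx.add hy
    | smul a x _ hx =>
      simpa only [map_smulₛₗ, smul_eq_mul, mul_left_comm] using hx.mul_left (conj a)
  | zero =>
    refine ⟨0, (map_zero _).symm, fun n => ⟨T.domain.zero_mem, T.map_zero⟩, fun χ => ?_⟩
    simp
  | add x y _ _ hx hy =>
    obtain ⟨s, s0, hs, hsum⟩ := hx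
    obtain ⟨s', s0', hs', hsum'⟩ := hy
    refine ⟨s + s', by simp [s0, s0'], fun n => ?_, fun χ => ?_⟩
    · obtain ⟨d, hd⟩ := hs n
      obtain ⟨d', hd'⟩ := hs' n
      refine ⟨T.domain.add_mem d d', ?_⟩
      exact (T.map_add ⟨s n, d⟩ ⟨s' n, d'⟩).trans (congrArg₂ (· + ·) hd hd')
    · simpa only [Pi.add_apply, LinearMap.add_apply, map_add, mul_add] using
        (hsum χ).add (hsum' χ)
  | smul a x _ hx =>
    obtain ⟨s, s0, hs, hsum⟩ := hx
    refine ⟨a • s, by simp [s0], fun n => ?_, fun χ => ?_⟩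
    · obtain ⟨d, hd⟩ := hs n
      refine ⟨T.domain.smul_mem a d, ?_⟩
      exact (T.map_smul a ⟨s n, d⟩).trans (congrArg (a • ·) hd)
    · simpa only [Pi.smul_apply, LinearMap.smul_apply, map_smul, smul_eq_mul, mul_left_comm] using
        (hsum χ).mul_left a

end Exponential

/-! ### Exponential series -/

/-- The Hermite-type polynomials with exponential generating function `exp (t y + c t² / 2)`. -/
def gaussPoly (c : ℂ) : ℕ → Polynomial ℂ
  | 0 => 1
  | n + 1 => Polynomial.X * gaussPoly c n + Polynomial.C c * (gaussPoly c n).derivative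

/-- The exponent has derivative `y + c t`, and the chain rule applied to a polynomial in `y + c t`
yields a factor `c`. The product rule is thus exactly the recursion of `gaussPoly` at the point `y +
c t`. -/
theorem iteratedDeriv_gauss (c y : ℂ) (n : ℕ) :
    iteratedDeriv n (fun t : ℂ => Complex.exp (t * y + c * t ^ 2 / 2)) =
      fun t => (gaussPoly c n).eval (y + c * t) * Complex.exp (t * y + c * t ^ 2 / 2) := by
  induction n with
  | zero => simp [gaussPoly]
  | succ n ih =>
    rw [iteratedDeriv_succ, ih]
    funext t
    have h1 : HasDerivAt (fun t : ℂ => y + c * t) c t := by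
      simpa using ((hasDerivAt_id t).const_mul c).const_add y
    have h2 := ((gaussPoly c n).hasDerivAt (y + c * t)).comp t h1
    have h3 : HasDerivAt (fun t : ℂ => t * y + c * t ^ 2 / 2) (y + c * t) t := by
      have h := ((hasDerivAt_id t).mul_const y).add
        ((((hasDerivAt_id t).pow 2).const_mul c).div_const 2)
      refine h.congr_deriv ?_
      push_cast
      simp only [id]
      ring
    refine (h2.mul h3.cexp).deriv.trans ?_
    simp only [gaussPoly, Polynomial.eval_add, Polynomial.eval_mul, Polynomial.eval_X,
      Polynomial.eval_C, Function.comp]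
    ring

theorem hasSum_gaussPoly (c y : ℂ) :
    HasSum (fun n : ℕ => ((n.factorial : ℂ)⁻¹) * (gaussPoly c n).eval y)
      (Complex.exp (y + c / 2)) := by
  have hd : Differentiable ℂ (fun t : ℂ => Complex.exp (t * y + c * t ^ 2 / 2)) := by fun_prop
  -- Taylor expansion in `t` about `0`, evaluated at `t = 1`.
  have h := Complex.hasSum_taylorSeries_of_entire hd 0 1
  simpa [iteratedDeriv_gauss] using h

theorem hasSum_pow_factorial (x : ℂ) :
    HasSum (fun n : ℕ => ((n.factorial : ℂ)⁻¹) * x ^ n) (Complex.exp x) := by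
  have h := NormedSpace.expSeries_div_hasSum_exp x
  rw [← Complex.exp_eq_exp_ℂ] at h
  simpa only [div_eq_inv_mul] using h

/-! ### Annihilation and creation operators on coherent states -/

namespace QuantumSpace

variable {V : Type*} [NormedAddCommGroup V] [InnerProductSpace ℂ V]
  {Q : Type*} [NormedAddCommGroup Q] [InnerProductSpace ℂ Q]

theorem dGamma_apply {S : QuantumSpace (Kl V) Q} {X : OsAlg V} {φ ψ : Antidual Q}
    (h : S.IsDGamma X φ ψ) :
    ∃ d : φ ∈ (S.dGamma X).domain, S.dGamma X ⟨φ, d⟩ = ψ :=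
  have d : φ ∈ (S.dGamma X).domain := ⟨ψ, h⟩
  ⟨d, (Exists.choose_spec d : S.IsDGamma X φ _).unique h⟩

/-- The limit defining `dΓ(X) φ` exists once it exists on coherent states. -/
theorem exists_dGamma (S : QuantumSpace (Kl V) Q) (X : OsAlg V) (φ : Antidual Q)
    (g : Kl V → ℂ)
    (h : ∀ z, HasDerivAt (fun ε : ℝ => φ (S.ket ((X.approx ε).toCoherentMap.adj z))) (g z) 0) :
    ∃ ψ : Antidual Q, (∃ d : φ ∈ (S.dGamma X).domain, S.dGamma X ⟨φ, d⟩ = ψ) ∧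
      ∀ z, ψ (S.ket z) = g z := by
  -- The difference quotient is antilinear in `χ` for each `ε`, so convergence on coherent states
  -- spreads to their span, and the limits form an antilinear functional.
  let D : Q → ℝ → ℂ := fun χ ε =>
    (ε : ℂ)⁻¹ * (S.quantizeDual (X.approx ε).toCoherentMap φ χ - φ χ)
  have hket : ∀ z, Tendsto (D (S.ket z)) (𝓝[≠] 0) (𝓝 (g z)) := by
    intro z
    refine (hasDerivAt_iff_tendsto_slope.mp (h z)).congr fun ε => ?_
    -- This makes the difference quotient the slope at `0` of a function of `ε`.
    have e0 : (X.approx 0).toCoherentMap.adj z = z := by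
      ext <;> simp [Os.toCoherentMap, OsAlg.approx, Hor.oneAddSmul]
    have e : S.quantizeDual (X.approx ε).toCoherentMap φ (S.ket z) =
        φ (S.ket ((X.approx ε).toCoherentMap.adj z)) :=
      congrArg φ (S.quantize_ket (X.approx ε).toCoherentMap.star z)
    simp only [D, slope, vsub_eq_sub, sub_zero, e0, e, Complex.real_smul, Complex.ofReal_inv]
  have hadd : ∀ {χ χ' l l'}, Tendsto (D χ) (𝓝[≠] 0) (𝓝 l) → Tendsto (D χ') (𝓝[≠] 0) (𝓝 l') →
      Tendsto (D (χ + χ')) (𝓝[≠] 0) (𝓝 (l + l')) := by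
    intro χ χ' l l' h h'
    refine (h.add h').congr fun ε => ?_
    simp only [D, map_add]
    ring
  have hsmul : ∀ (a : ℂ) {χ l}, Tendsto (D χ) (𝓝[≠] 0) (𝓝 l) →
      Tendsto (D (a • χ)) (𝓝[≠] 0) (𝓝 (conj a • l)) := by
    intro a χ l h
    refine (h.const_mul (conj a)).congr fun ε => ?_
    simp only [D, map_smulₛₗ, smul_eq_mul]
    ring
  have hex : ∀ χ, ∃ l, Tendsto (D χ) (𝓝[≠] 0) (𝓝 l) := by
    intro χ
    have hχ : χ ∈ Submodule.span ℂ (Set.range S.ket) := by rw [S.span_ket]; trivial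
    induction hχ using Submodule.span_induction with
    | mem x hx => obtain ⟨z, rfl⟩ := hx; exact ⟨_, hket z⟩
    | zero => exact ⟨0, by simp [D]⟩
    | add x y _ _ hx hy => exact ⟨_, hadd hx.choose_spec hy.choose_spec⟩
    | smul a x _ hx => exact ⟨_, hsmul a hx.choose_spec⟩
  choose l hl using hex
  let ψ : Antidual Q :=
    { toFun := l
      map_add' := fun χ χ' => tendsto_nhds_unique (hl _) (hadd (hl χ) (hl χ'))
      map_smul' := fun a χ => tendsto_nhds_unique (hl _) (hsmul a (hl χ)) }
  exact ⟨ψ, dGamma_apply (show S.IsDGamma X φ ψ from hl),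
    fun z => tendsto_nhds_unique (hl _) (hket z)⟩

/-- The adjoint map translates `z.vec` by `ε p`. This moves the argument of `f` by `ε p*q` and the
exponent of `K z w` by `ε p*w`; the product rule gives the two terms. -/
theorem exists_annihilation (S : QuantumSpace (Kl V) Q) (p q : V) (w : Kl V) {f f' : ℂ → ℂ}
    (hf : ∀ x, HasDerivAt f (f' x) x) {φ : Antidual Q}
    (hφ : ∀ z, φ (S.ket z) = f ⟪z.vec, q⟫_ℂ * K z w) :
    ∃ ψ : Antidual Q, (∃ d : φ ∈ (S.annihilation p).domain, S.annihilation p ⟨φ, d⟩ = ψ) ∧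
      ∀ z, ψ (S.ket z) =
        (⟪p, q⟫_ℂ * f' ⟪z.vec, q⟫_ℂ + ⟪p, w.vec⟫_ℂ * f ⟪z.vec, q⟫_ℂ) * K z w := by
  refine S.exists_dGamma _ φ _ fun z => ?_
  have hlin : ∀ a b : ℂ, HasDerivAt (fun ε : ℝ => a + ε * b) b 0 := fun a b => by
    simpa using ((hasDerivAt_id (0 : ℝ)).ofReal_comp.mul_const b).const_add a
  have h1 := (hf (⟪z.vec, q⟫_ℂ + (0 : ℝ) * ⟪p, q⟫_ℂ)).comp (0 : ℝ) (hlin ⟪z.vec, q⟫_ℂ ⟪p, q⟫_ℂ)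
  have h2 := (hlin (conj z.zero + w.zero + ⟪z.vec, w.vec⟫_ℂ) ⟪p, w.vec⟫_ℂ).cexp
  refine ((h1.mul h2).congr_deriv ?_).congr_of_eventuallyEq (.of_forall fun ε => ?_)
  · change _ = _ * Kl.prod _ _
    simp only [Kl.prod, Function.comp, Complex.ofReal_zero, zero_mul, add_zero]
    ring
  · beta_reduce
    rw [hφ]
    change _ * Kl.prod _ _ = _
    simp [Os.toCoherentMap, OsAlg.approx, Hor.oneAddSmul, Hor.zero, Kl.prod, add_comm,
      add_left_comm, add_assoc]

/-- The adjoint map leaves `z.vec` fixed and changes only the scalar component, so `f` may be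
arbitrary and only the exponential is differentiated. -/
theorem exists_creation (S : QuantumSpace (Kl V) Q) (q : V) (w : Kl V) {f : V → ℂ}
    {φ : Antidual Q} (hφ : ∀ z, φ (S.ket z) = f z.vec * K z w) :
    ∃ ψ : Antidual Q, (∃ d : φ ∈ (S.creation q).domain, S.creation q ⟨φ, d⟩ = ψ) ∧
      ∀ z, ψ (S.ket z) = ⟪z.vec, q⟫_ℂ * f z.vec * K z w := by
  refine S.exists_dGamma _ φ _ fun z => ?_
  have hlin : ∀ a b : ℂ, HasDerivAt (fun ε : ℝ => a + ε * b) b 0 := fun a b => by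
    simpa using ((hasDerivAt_id (0 : ℝ)).ofReal_comp.mul_const b).const_add a
  have h2 := (hlin (conj z.zero + w.zero + ⟪z.vec, w.vec⟫_ℂ) ⟪z.vec, q⟫_ℂ).cexp.const_mul (f z.vec)
  refine (h2.congr_deriv ?_).congr_of_eventuallyEq (.of_forall fun ε => ?_)
  · change _ = _ * Kl.prod _ _
    simp only [Kl.prod, Complex.ofReal_zero, zero_mul, add_zero]
    ring
  · beta_reduce
    rw [hφ]
    change _ * Kl.prod _ _ = _
    simp [Os.toCoherentMap, OsAlg.approx, Hor.oneAddSmul, Hor.zero, Kl.prod, add_comm,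
      add_left_comm]

end QuantumSpace

/-! ### Quantization of the Heisenberg group -/

/-- The element `[ρ, p, q, 1]` of the oscillator semigroup. -/
def Os.heisenberg {V : Type*} [NormedAddCommGroup V] [InnerProductSpace ℂ V] (ρ : ℂ) (p q : V) :
    Os V :=
  ⟨ρ, p, q, ⟨1, 1, fun _ _ => rfl⟩⟩

namespace QuantumSpace

variable {V : Type*} [NormedAddCommGroup V] [InnerProductSpace ℂ V]
  {Q : Type*} [NormedAddCommGroup Q] [InnerProductSpace ℂ Q] (S : QuantumSpace (Kl V) Q)

/-- The quantization of the element `[ρ, p, q, 1]` of the oscillator semigroup. -/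
def heisenberg (ρ : ℂ) (p q : V) : End ℂ Q :=
  S.quantize (Os.heisenberg ρ p q).toCoherentMap

theorem heisenberg_ket (ρ : ℂ) (p q : V) (z : Kl V) :
    S.heisenberg ρ p q (S.ket z) = S.ket ⟨ρ + z.zero + ⟪p, z.vec⟫_ℂ, q + z.vec⟩ :=
  S.quantize_ket _ z

theorem inner_ket_heisenberg (ρ : ℂ) (p q : V) (z w : Kl V) :
    ⟪S.ket z, S.heisenberg ρ p q (S.ket w)⟫_ℂ =
      Complex.exp (ρ + ⟪p, w.vec⟫_ℂ + ⟪z.vec, q⟫_ℂ) * K z w := by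
  rw [heisenberg_ket, S.inner_ket]
  change Kl.prod _ _ = _ * Kl.prod _ _
  rw [Kl.prod, Kl.prod, ← Complex.exp_add, inner_add_right]
  ring_nf

theorem heisenberg_mul (ρ ρ' : ℂ) (p q p' q' : V) :
    S.heisenberg ρ p q * S.heisenberg ρ' p' q' =
      S.heisenberg (ρ + ρ' + ⟪p, q'⟫_ℂ) (p + p') (q + q') := by
  refine LinearMap.ext_on_range S.span_ket fun z => ?_
  rw [Module.End.mul_apply, heisenberg_ket, heisenberg_ket, heisenberg_ket]
  congr 2
  · simp only [inner_add_left, inner_add_right]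
    ring
  · exact (add_assoc _ _ _).symm

/-- The scalar component of a label enters the coherent product only as an exponential factor, so
both sides have the same matrix elements between coherent states. -/
theorem exp_smul_heisenberg (a ρ : ℂ) (p q : V) :
    Complex.exp a • S.heisenberg ρ p q = S.heisenberg (a + ρ) p q := by
  refine LinearMap.ext_on_range S.span_ket fun w => ?_
  rw [← sub_eq_zero]
  refine S.eq_zero_of_inner_ket fun z => ?_
  rw [inner_sub_right, LinearMap.smul_apply, inner_smul_right, inner_ket_heisenberg,
    inner_ket_heisenberg, ← mul_assoc, ← Complex.exp_add, sub_eq_zero]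
  ring_nf

theorem heisenberg_zero : S.heisenberg 0 (0 : V) 0 = 1 := by
  refine LinearMap.ext_on_range S.span_ket fun z => ?_
  simp [heisenberg_ket]

/-! ### The exponentials as Heisenberg operators -/

theorem isExp_annihilation (p : V) : IsExp (S.annihilation p) (S.heisenberg 0 p 0) := by
  refine S.isExp_of_ket (fun w n z => ⟪p, w.vec⟫_ℂ ^ n * K z w) (fun w z => by simp)
    (fun w n φ hφ => ?_) fun w z => ?_
  · obtain ⟨ψ, hd, hψ⟩ := S.exists_annihilation p 0 w
      (f := fun _ => ⟪p, w.vec⟫_ℂ ^ n) (f' := fun _ => 0) (fun x => hasDerivAt_const x _) hφ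
    refine ⟨ψ, hd, fun z => ?_⟩
    rw [hψ]
    ring
  · rw [inner_ket_heisenberg]
    simpa [mul_assoc] using (hasSum_pow_factorial ⟪p, w.vec⟫_ℂ).mul_right (K z w)

theorem isExp_creation (q : V) : IsExp (S.creation q) (S.heisenberg 0 0 q) := by
  refine S.isExp_of_ket (fun w n z => ⟪z.vec, q⟫_ℂ ^ n * K z w) (fun w z => by simp)
    (fun w n φ hφ => ?_) fun w z => ?_
  · obtain ⟨ψ, hd, hψ⟩ := S.exists_creation q w (f := fun v => ⟪v, q⟫_ℂ ^ n) hφ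
    refine ⟨ψ, hd, fun z => ?_⟩
    rw [hψ]
    ring
  · rw [inner_ket_heisenberg]
    simpa [mul_assoc] using (hasSum_pow_factorial ⟪z.vec, q⟫_ℂ).mul_right (K z w)

theorem isExp_annihilation_add_creation (p q : V) :
    IsExp (S.annihilation p + S.creation q) (S.heisenberg (⟪p, q⟫_ℂ / 2) p q) := by
  refine S.isExp_of_ket
    (fun w n z => (gaussPoly ⟪p, q⟫_ℂ n).eval (⟪z.vec, q⟫_ℂ + ⟪p, w.vec⟫_ℂ) * K z w)
    (fun w z => by simp [gaussPoly]) (fun w n φ hφ => ?_) fun w z => ?_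
  · obtain ⟨ψ, ⟨d, hd⟩, hψ⟩ := S.exists_annihilation p q w
      (f := fun x => (gaussPoly ⟪p, q⟫_ℂ n).eval (x + ⟪p, w.vec⟫_ℂ))
      (f' := fun x => (gaussPoly ⟪p, q⟫_ℂ n).derivative.eval (x + ⟪p, w.vec⟫_ℂ))
      (fun x => ((gaussPoly ⟪p, q⟫_ℂ n).hasDerivAt _).comp_add_const x _) hφ
    obtain ⟨ψ', ⟨d', hd'⟩, hψ'⟩ := S.exists_creation q w
      (f := fun v => (gaussPoly ⟪p, q⟫_ℂ n).eval (⟪v, q⟫_ℂ + ⟪p, w.vec⟫_ℂ)) hφ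
    -- The sum is defined on the intersection of the two domains. On values, the terms `p*w` and
    -- `z*q` combine to the variable `y` of the `gaussPoly` recursion.
    refine ⟨ψ + ψ', ⟨⟨d, d'⟩, ?_⟩, fun z => ?_⟩
    · rw [LinearPMap.add_apply, ← hd, ← hd']
    · rw [LinearMap.add_apply, hψ, hψ']
      simp only [gaussPoly, Polynomial.eval_add, Polynomial.eval_mul, Polynomial.eval_X,
        Polynomial.eval_C]
      ring
  · rw [inner_ket_heisenberg]
    have h := (hasSum_gaussPoly ⟪p, q⟫_ℂ (⟪z.vec, q⟫_ℂ + ⟪p, w.vec⟫_ℂ)).mul_right (K z w)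
    rw [show ⟪p, q⟫_ℂ / 2 + ⟪p, w.vec⟫_ℂ + ⟪z.vec, q⟫_ℂ =
      ⟪z.vec, q⟫_ℂ + ⟪p, w.vec⟫_ℂ + ⟪p, q⟫_ℂ / 2 by ring]
    simpa only [mul_assoc] using h

theorem weyl_eq_heisenberg (p q : V) : S.weyl p q = S.heisenberg ⟪p, q⟫_ℂ p q := by
  rw [weyl, (S.isExp_annihilation p).opExp_eq, (S.isExp_creation q).opExp_eq, heisenberg_mul]
  simp

theorem expSum_eq_heisenberg (p q : V) : S.expSum p q = S.heisenberg (⟪p, q⟫_ℂ / 2) p q :=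
  (S.isExp_annihilation_add_creation p q).opExp_eq

end QuantumSpace

/-! ### The symplectic form -/

theorem weylForm_apply {V : Type*} [NormedAddCommGroup V] [InnerProductSpace ℂ V] (x y : V × V) :
    weylForm V x y = ⟪x.1, y.2⟫_ℂ - ⟪y.1, x.2⟫_ℂ := rfl

theorem weylForm_isAlt (V : Type*) [NormedAddCommGroup V] [InnerProductSpace ℂ V] :
    (weylForm V).IsAlt := fun _ => sub_self _

theorem weylForm_nondegenerate (V : Type*) [NormedAddCommGroup V] [InnerProductSpace ℂ V] :
    (weylForm V).Nondegenerate := by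
  refine ⟨fun x h => ?_, fun x h => ?_⟩
  · have h1 := h (0, x.1)
    have h2 := h (x.2, 0)
    simp only [weylForm_apply, inner_zero_left, inner_zero_right, sub_zero, zero_sub,
      neg_eq_zero, inner_self_eq_zero] at h1 h2
    exact Prod.ext h1 h2
  · have h1 := h (0, x.1)
    have h2 := h (x.2, 0)
    simp only [weylForm_apply, inner_zero_left, inner_zero_right, sub_zero, zero_sub,
      neg_eq_zero, inner_self_eq_zero] at h1 h2
    exact Prod.ext h1 h2

end

theorem theoremt {V : Type*} [NormedAddCommGroup V] [InnerProductSpace ℂ V]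
    {Q : Type*} [NormedAddCommGroup Q] [InnerProductSpace ℂ Q] (S : QuantumSpace (Kl V) Q) :
    -- the exponentials exist as linear operators on the quantum space and are unique
    (∀ p : V, (∃! U, IsExp (S.annihilation p) U) ∧
      IsExp (S.annihilation p) (opExp (S.annihilation p))) ∧
    (∀ q : V, (∃! U, IsExp (S.creation q) U) ∧
      IsExp (S.creation q) (opExp (S.creation q))) ∧
    (∀ p q : V, (∃! U, IsExp (S.annihilation p + S.creation q) U) ∧
      IsExp (S.annihilation p + S.creation q) (S.expSum p q)) ∧
    -- Weyl relations
    (∀ p q : V, opExp (S.annihilation p) * opExp (S.creation q) =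
      Complex.exp ⟪p, q⟫_ℂ • (opExp (S.creation q) * opExp (S.annihilation p))) ∧
    -- product, inverse and commutation rules for the complex Weyl operators
    (∀ p q p' q' : V, S.weyl p q * S.weyl p' q' =
      Complex.exp (-⟪p', q⟫_ℂ) • S.weyl (p + p') (q + q')) ∧
    (∀ p q : V, S.weyl p q * (Complex.exp (-⟪p, q⟫_ℂ) • S.weyl (-p) (-q)) = 1 ∧
      (Complex.exp (-⟪p, q⟫_ℂ) • S.weyl (-p) (-q)) * S.weyl p q = 1) ∧
    (∀ p q p' q' : V, S.weyl p q * S.weyl p' q' =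
      Complex.exp (⟪p, q'⟫_ℂ - ⟪p', q⟫_ℂ) • (S.weyl p' q' * S.weyl p q)) ∧
    -- the exponentials of the operator sums
    (∀ p q : V, S.expSum p q = Complex.exp (-⟪p, q⟫_ℂ / 2) • S.weyl p q) ∧
    (∀ p q p' q' : V, S.expSum p q * S.expSum p' q' =
      Complex.exp ((⟪p, q'⟫_ℂ - ⟪p', q⟫_ℂ) / 2) • S.expSum (p + p') (q + q')) ∧
    (∀ p q : V, S.expSum p q * S.expSum (-p) (-q) = 1 ∧
      S.expSum (-p) (-q) * S.expSum p q = 1) ∧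
    (∀ p q p' q' : V, S.expSum p q * S.expSum p' q' =
      Complex.exp (⟪p, q'⟫_ℂ - ⟪p', q⟫_ℂ) • (S.expSum p' q' * S.expSum p q)) ∧
    -- the exponent in the commutation rules is a symplectic form
    (∀ p q p' q' : V, weylForm V (p, q) (p', q') = ⟪p, q'⟫_ℂ - ⟪p', q⟫_ℂ) ∧
    (weylForm V).IsAlt ∧ (weylForm V).Nondegenerate ∧
    (∀ (c : ℂ) (p q : V) (y : V × V),
      weylForm V (conj c • p, c • q) y = c * weylForm V (p, q) y) := by
  -- This turns both sides of each product relation into single Heisenberg operators, leaving their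
  -- parameters to be compared.
  simp only [(S.isExp_annihilation _).opExp_eq, (S.isExp_creation _).opExp_eq,
    S.weyl_eq_heisenberg, S.expSum_eq_heisenberg, S.exp_smul_heisenberg, S.heisenberg_mul]
  refine ⟨fun p => ?_, fun q => ?_, fun p q => ?_, fun p q => ?_, fun p q p' q' => ?_,
    fun p q => ⟨?_, ?_⟩, fun p q p' q' => ?_, fun p q => ?_, fun p q p' q' => ?_,
    fun p q => ⟨?_, ?_⟩, fun p q p' q' => ?_, fun p q p' q' => weylForm_apply _ _,
    weylForm_isAlt V, weylForm_nondegenerate V, fun c p q y => ?_⟩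
  · exact ⟨(S.isExp_annihilation p).existsUnique, S.isExp_annihilation p⟩
  · exact ⟨(S.isExp_creation q).existsUnique, S.isExp_creation q⟩
  · exact ⟨(S.isExp_annihilation_add_creation p q).existsUnique,
      S.isExp_annihilation_add_creation p q⟩
  · simp
  · congr 1
    simp only [inner_add_left, inner_add_right]
    ring
  · rw [← S.heisenberg_zero, add_neg_cancel, add_neg_cancel]
    congr 1
    simp only [inner_neg_left, inner_neg_right]
    ring
  · rw [← S.heisenberg_zero, neg_add_cancel, neg_add_cancel]
    congr 1
    simp only [inner_neg_left, inner_neg_right]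
    ring
  · rw [add_comm p', add_comm q']
    congr 1
    ring
  · congr 1
    ring
  · congr 1
    simp only [inner_add_left, inner_add_right]
    ring
  · rw [← S.heisenberg_zero, add_neg_cancel, add_neg_cancel]
    congr 1
    simp only [inner_neg_left, inner_neg_right]
    ring
  · rw [← S.heisenberg_zero, neg_add_cancel, neg_add_cancel]
    congr 1
    simp only [inner_neg_left, inner_neg_right]
    ring
  · rw [add_comm p', add_comm q']
    congr 1
    ring
  -- The conjugate in `conj c • p` cancels the antilinearity of the inner product in its first slot.
  · simp only [weylForm_apply, inner_smul_left, inner_smul_right, Complex.conj_conj]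
    ring
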